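/- Let $W=(W_t)_{t\ge 0}$ be a standard linear Brownian motion on a probability space, and for $\kappa>0$ let $\zeta^\kappa_t=e^{iW_{\kappa t}}$ be the Brownian motion of variance $\kappa$ on the unit circle $S^1$. For $z$ in the open unit disk $\mathbb D$ consider the radial Loewner equation $$\partial_t g^\kappa_t(z)=-g^\kappa_t(z)\,\frac{g^\kappa_t(z)+\zeta^\kappa_t}{g^\kappa_t(z)-\zeta^\kappa_t},\qquad g^\kappa_0(z)=z,$$ let $D^\kappa_t$ be the set of $z\in\mathbb D$ for which the solution exists in $\mathbb D$ up to time $t$, and let $f^\kappa_t=(g^\kappa_t)^{-1}:\mathbb D\to D^\kappa_t$ be the radial Loewner chain driven by $\zeta^\kappa$. Then, almost surely, as $\kappa\to\infty$ (through the positive reals): 1. $\{f^\kappa_t\}_{t\in[0,1]}$ converges to $\{z\mapsto e^{-t}z\}_{t\in[0,1]}$ in the uniform Carathéodory topology, that is, $f^\kappa_t(z)\to e^{-t}z$ uniformly in $(z,t)$ on every compact subset of $\mathbb D\times[0,1]$; 2. the driving measures $\delta_{\zeta^\kappa_t}(d\zeta)\,dt$ converge weakly, as probability measures on $S^1\times[0,1]$,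 to the uniform measure $(2\pi)^{-1}\mathrm{Leb}_{S^1}\otimes\mathrm{Leb}_{[0,1]}$. -/

import Mathlib

open MeasureTheory ProbabilityTheory Filter Topology
open scoped NNReal

namespace RadialLoewner

noncomputable section

/-- The circular Brownian path `ζ_t = exp (i W_{κ t})` (`t ≥ 0`) of variance `κ`, for the sample
point `ω`. Only times `t ∈ [0, 1]` and parameters `κ ≥ 0` are used. -/
def circularPath {Ω : Type*} (W : ℝ≥0 → Ω → ℝ) (κ : ℝ) (ω : Ω) (t : ℝ) : Circle :=
  Circle.exp (W (Real.toNNReal (κ * t)) ω)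

/-- The vector field `z ↦ -z (z + ζ) / (z - ζ)` of the radial Loewner equation. -/
def vectorField (ζ : Circle) (z : ℂ) : ℂ :=
  -z * ((z + (ζ : ℂ)) / (z - (ζ : ℂ)))

/-- `g` solves, on the time interval `[0, t]` and inside the open unit disk, the radial Loewner
equation `∂ₛ gₛ = -gₛ (gₛ + ζₛ) / (gₛ - ζₛ)` with `g₀ = z`. -/
def IsSolution (ζ : ℝ → Circle) (z : ℂ) (t : ℝ) (g : ℝ → ℂ) : Prop :=
  g 0 = z ∧ ∀ s ∈ Set.Icc (0 : ℝ) t, g s ∈ Metric.ball (0 : ℂ) 1 ∧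
    HasDerivWithinAt g (vectorField (ζ s) (g s)) (Set.Icc 0 t) s

/-- The domain `D_t`: the starting points whose solution exists in the disk up to time `t`. -/
def domain (ζ : ℝ → Circle) (t : ℝ) : Set ℂ :=
  {z | ∃ g, IsSolution ζ z t g}

open Classical in
/-- The flow map `g_t`, with domain `D_t` (and the value `0` off `D_t`). -/
def flow (ζ : ℝ → Circle) (t : ℝ) (z : ℂ) : ℂ :=
  if h : z ∈ domain ζ t then Classical.choose h t else 0

/-- The radial Loewner chain driven by `ζ`: `f_t = g_t⁻¹`, the inverse of `g_t : D_t → 𝔻`. -/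
def chain (ζ : ℝ → Circle) (t : ℝ) : ℂ → ℂ :=
  Function.invFunOn (flow ζ t) (domain ζ t)

/-- Convergence of time-indexed families of maps of the disk in the uniform Carathéodory
topology: `f(z, t) = f_t(z)` converges uniformly on the compact subsets of `𝔻 × [0, 1]`. -/
def TendstoCaratheodory {ι : Type*} (F : ι → ℝ → ℂ → ℂ) (l : Filter ι) (f : ℝ → ℂ → ℂ) : Prop :=
  ∀ K : Set (ℂ × ℝ), IsCompact K → K ⊆ Metric.ball (0 : ℂ) 1 ×ˢ Set.Icc (0 : ℝ) 1 →
    TendstoUniformlyOn (fun i p => F i p.2 p.1) (fun p => f p.2 p.1) l K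

/-- The circle carries its Borel σ-algebra. -/
instance instMeasurableSpaceCircle : MeasurableSpace Circle := borel Circle

instance instBorelSpaceCircle : BorelSpace Circle := ⟨rfl⟩

/-- The driving measure `δ_{ζ_t}(dζ) dt` on `S¹ × [0, 1]`, that is, the image of Lebesgue measure
on `[0, 1]` under `t ↦ (ζ_t, t)`. -/
def drivingMeasure (ζ : ℝ → Circle) (hζ : Continuous ζ) :
    ProbabilityMeasure (Circle × unitInterval) :=
  ProbabilityMeasure.map (⟨volume, inferInstance⟩ : ProbabilityMeasure unitInterval)
    (f := fun t : unitInterval => (ζ t, t))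
    (by fun_prop : Continuous fun t : unitInterval => (ζ t, t)).measurable.aemeasurable

/-- Normalized arc length `(2π)⁻¹ Leb` on the unit circle. -/
def uniformCircle : Measure Circle :=
  (ENNReal.ofReal (2 * Real.pi))⁻¹ •
    (volume.restrict (Set.Ioc (0 : ℝ) (2 * Real.pi))).map Circle.exp

instance instIsProbabilityMeasureUniformCircle : IsProbabilityMeasure uniformCircle := by
  constructor
  have h : (0 : ℝ) < 2 * Real.pi := by positivity
  rw [uniformCircle, Measure.smul_apply,
    Measure.map_apply Circle.exp.continuous.measurable MeasurableSet.univ]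
  simp only [Set.preimage_univ, Measure.restrict_apply MeasurableSet.univ, Set.univ_inter,
    Real.volume_Ioc, sub_zero, smul_eq_mul]
  exact ENNReal.inv_mul_cancel (by simpa using h) ENNReal.ofReal_ne_top

/-- The uniform probability measure `(2π)⁻¹ Leb ⊗ Leb` on `S¹ × [0, 1]`. -/
def uniformMeasure : ProbabilityMeasure (Circle × unitInterval) :=
  ⟨uniformCircle.prod volume, inferInstance⟩

end

end RadialLoewner

/-! The proof separates a probabilistic input from two deterministic consequences. The input,
`AveragesOut`, says that the primitive of every nonzero power of the driving function tends to zero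
uniformly on `[0, 1]`.

Loewner chains: the field expands as `z + 2 ∑ z^(n+2) ζ^(-(n+1))`, so only `z` survives averaging,
and the inverse flow of `∂g = g` is `e⁻ᵗ z`. In reversed time `f_t(z)` is the endpoint of a
trajectory from `z` that moves inward, hence stays where the field is Lipschitz. The fluctuation of
the field is not small, only its time integral is; `norm_chain_sub_le` absorbs that integral into
the unknown before applying Gronwall.

Driving measures: on the compact space `S¹ × [0, 1]` it suffices to test against `ζⁿ tᵐ`, and
integration by parts removes the factor `tᵐ`.

Probability: the covariance of `exp (i c W)` decays exponentially, so its integral over `[0, T]` has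
second moment `O(T)`. Along `T = k²` the averages have summable second moments and tend to zero
almost surely; monotone interpolation between squares and the scaling `u = κ s` give `AveragesOut`.
-/

namespace RadialLoewner

open Metric Set

/-! ### Estimates for the radial Loewner vector field. -/

lemma one_sub_le_norm_sub (ζ : Circle) {z : ℂ} {R : ℝ} (hz : ‖z‖ ≤ R) :
    1 - R ≤ ‖z - (ζ : ℂ)‖ := by
  have h := norm_sub_norm_le (ζ : ℂ) z
  rw [Circle.norm_coe, norm_sub_rev] at h
  linarith

lemma sub_circle_ne_zero (ζ : Circle) {z : ℂ} (hz : ‖z‖ < 1) : z - (ζ : ℂ) ≠ 0 := by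
  have h := one_sub_le_norm_sub ζ (le_refl ‖z‖)
  rw [← norm_pos_iff]
  linarith

lemma vectorField_eq (ζ : Circle) {z : ℂ} (hz : ‖z‖ < 1) :
    vectorField ζ z = -z - 2 * ζ - 2 * (ζ : ℂ) ^ 2 / (z - ζ) := by
  have h := sub_circle_ne_zero ζ hz
  rw [vectorField]
  field_simp
  ring

/-- After isolating the pole, the difference quotient is `-1 + 2ζ² / ((z - ζ)(w - ζ))`, and both
factors of the denominator have norm at least `1 - R`. -/
lemma norm_vectorField_sub_le (ζ : Circle) {R : ℝ} (hR : R < 1) {z w : ℂ}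
    (hz : ‖z‖ ≤ R) (hw : ‖w‖ ≤ R) :
    ‖vectorField ζ z - vectorField ζ w‖ ≤ (1 + 2 / (1 - R) ^ 2) * ‖z - w‖ := by
  have h1 := sub_circle_ne_zero ζ (hz.trans_lt hR)
  have h2 := sub_circle_ne_zero ζ (hw.trans_lt hR)
  have hR' : 0 < 1 - R := by linarith
  have key : vectorField ζ z - vectorField ζ w
      = (-1 + 2 * (ζ : ℂ) ^ 2 / ((z - ζ) * (w - ζ))) * (z - w) := by
    rw [vectorField_eq ζ (hz.trans_lt hR), vectorField_eq ζ (hw.trans_lt hR)]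
    field_simp
    ring
  rw [key, norm_mul]
  gcongr
  refine (norm_add_le _ _).trans ?_
  rw [norm_neg, norm_one, norm_div, norm_mul, norm_mul, norm_pow, Circle.norm_coe, sq (1 - R)]
  simp only [RCLike.norm_ofNat, one_pow, mul_one]
  have h3 := one_sub_le_norm_sub ζ hz
  have h4 := one_sub_le_norm_sub ζ hw
  gcongr

lemma lipschitzOnWith_vectorField (ζ : Circle) {R : ℝ} (hR : R < 1) :
    LipschitzOnWith (Real.toNNReal (1 + 2 / (1 - R) ^ 2)) (vectorField ζ) (closedBall 0 R) := by
  refine LipschitzOnWith.of_dist_le_mul fun z hz w hw => ?_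
  rw [dist_eq_norm, dist_eq_norm, Real.coe_toNNReal _ (by positivity)]
  exact norm_vectorField_sub_le ζ hR (by simpa using hz) (by simpa using hw)

@[simp]
lemma vectorField_zero (ζ : Circle) : vectorField ζ 0 = 0 := by simp [vectorField]

/-- The field points outward because `Re (-(z + ζ) / (z - ζ))` is the Poisson kernel `(1 - |z|²) /
|z - ζ|²`. The factor `c` allows `z` to be the radial truncation of a point `w` that may lie outside
the disk. -/
lemma inner_vectorField_nonneg (ζ : Circle) {z : ℂ} (hz : ‖z‖ < 1) (c : ℝ) (hc : 0 ≤ c) (w : ℂ)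
    (hw : z = c * w) : 0 ≤ inner ℝ w (vectorField ζ z) := by
  have h1 := sub_circle_ne_zero ζ hz
  have h2 : vectorField ζ z = ((c / Complex.normSq (z - ζ) : ℝ) : ℂ) *
      (w * -((z + ζ) * (starRingEnd ℂ) (z - ζ))) := by
    rw [vectorField, div_eq_mul_inv, Complex.inv_def]
    push_cast
    nth_rw 1 [hw]
    ring
  have h3 : inner ℝ w (vectorField ζ z) = c / Complex.normSq (z - ζ) *
      (Complex.normSq w * (-((z + ζ) * (starRingEnd ℂ) (z - ζ))).re) := by
    rw [h2, ← Complex.real_smul, inner_smul_right, Complex.inner]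
    generalize -((z + ζ) * (starRingEnd ℂ) (z - ζ)) = m
    rw [show w * m * (starRingEnd ℂ) w = (Complex.normSq w : ℂ) * m by
      rw [← Complex.mul_conj]; ring, Complex.re_ofReal_mul]
  have h4 : (-((z + ζ) * (starRingEnd ℂ) (z - ζ))).re = 1 - ‖z‖ ^ 2 := by
    have hζ : (ζ : ℂ).re * (ζ : ℂ).re + (ζ : ℂ).im * (ζ : ℂ).im = 1 := by
      rw [← Complex.normSq_apply, Circle.normSq_coe]
    rw [Complex.sq_norm, Complex.normSq_apply]
    simp only [Complex.neg_re, Complex.mul_re, Complex.add_re, Complex.add_im, Complex.conj_re,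
      Complex.conj_im, Complex.sub_re, Complex.sub_im]
    linear_combination hζ
  rw [h3, h4]
  have h5 : 0 ≤ 1 - ‖z‖ ^ 2 := by nlinarith [norm_nonneg z]
  have h6 := Complex.normSq_nonneg w
  have h7 := Complex.normSq_nonneg (z - ζ)
  positivity

lemma continuous_vectorField {ζ : ℝ → Circle} (hζ : Continuous ζ) {z : ℂ} (hz : ‖z‖ < 1) :
    Continuous fun s => vectorField (ζ s) z := by
  unfold vectorField
  have h : ∀ s, z - (ζ s : ℂ) ≠ 0 := fun s => sub_circle_ne_zero _ hz
  have h' : Continuous fun s => (ζ s : ℂ) := continuous_subtype_val.comp hζ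
  fun_prop (disch := exact h _)

/-! ### Existence and uniqueness of trajectories; the chain as reversed flow. -/

/-- The radial retraction of the plane onto the closed disk of radius `R`. -/
noncomputable def radialRetraction (R : ℝ) (z : ℂ) : ℂ := (R / max R ‖z‖ : ℝ) * z

lemma norm_radialRetraction_le {R : ℝ} (hR : 0 < R) (z : ℂ) : ‖radialRetraction R z‖ ≤ R := by
  have h : 0 < max R ‖z‖ := lt_max_of_lt_left hR
  rw [radialRetraction, norm_mul, Complex.norm_real, Real.norm_of_nonneg (by positivity),
    div_mul_eq_mul_div, div_le_iff₀ h]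
  gcongr
  exact le_max_right _ _

lemma radialRetraction_of_norm_le {R : ℝ} (hR : 0 < R) {z : ℂ} (hz : ‖z‖ ≤ R) :
    radialRetraction R z = z := by
  rw [radialRetraction, max_eq_left hz, div_self hR.ne']
  simp

lemma norm_radialRetraction_sub_le {R : ℝ} (hR : 0 < R) (z w : ℂ) :
    ‖radialRetraction R z - radialRetraction R w‖ ≤ 2 * ‖z - w‖ := by
  have hz : 0 < max R ‖z‖ := lt_max_of_lt_left hR
  have hw : 0 < max R ‖w‖ := lt_max_of_lt_left hR
  have key : radialRetraction R z - radialRetraction R w = (R / max R ‖z‖ : ℝ) * (z - w) +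
      ((R / max R ‖z‖ * ((max R ‖w‖ - max R ‖z‖) / max R ‖w‖) : ℝ) : ℂ) * w := by
    have : R / max R ‖z‖ * ((max R ‖w‖ - max R ‖z‖) / max R ‖w‖)
        = R / max R ‖z‖ - R / max R ‖w‖ := by
      field_simp
    rw [this, radialRetraction, radialRetraction]
    push_cast
    ring
  have h1 : R / max R ‖z‖ ≤ 1 := div_le_one_of_le₀ (le_max_left _ _) hz.le
  have h2 : |max R ‖w‖ - max R ‖z‖| ≤ ‖z - w‖ := by
    rw [max_comm R, max_comm R, norm_sub_rev z w]
    exact (abs_max_sub_max_le_abs ‖w‖ ‖z‖ R).trans (abs_norm_sub_norm_le w z)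
  have h3 : ‖w‖ / max R ‖w‖ ≤ 1 := div_le_one_of_le₀ (le_max_right _ _) hw.le
  rw [key, two_mul]
  refine (norm_add_le _ _).trans (add_le_add ?_ ?_)
  · rw [norm_mul, Complex.norm_real, Real.norm_of_nonneg (by positivity)]
    exact mul_le_of_le_one_left (norm_nonneg _) h1
  · rw [norm_mul, Complex.norm_real, Real.norm_eq_abs, abs_mul, abs_of_pos (div_pos hR hz),
      abs_div, abs_of_pos hw]
    calc R / max R ‖z‖ * (|max R ‖w‖ - max R ‖z‖| / max R ‖w‖) * ‖w‖
        = R / max R ‖z‖ * |max R ‖w‖ - max R ‖z‖| * (‖w‖ / max R ‖w‖) := by ring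
      _ ≤ 1 * ‖z - w‖ * 1 := by gcongr
      _ = ‖z - w‖ := by ring

lemma antitoneOn_norm_of_inner_nonpos {h h' : ℝ → ℂ} {t : ℝ}
    (hd : ∀ s ∈ Icc 0 t, HasDerivWithinAt h (h' s) (Icc 0 t) s)
    (hi : ∀ s ∈ Icc 0 t, inner ℝ (h s) (h' s) ≤ 0) : AntitoneOn (fun s => ‖h s‖) (Icc 0 t) := by
  have : AntitoneOn (fun s => ‖h s‖ ^ 2) (Icc 0 t) := by
    refine antitoneOn_of_hasDerivWithinAt_nonpos (f' := fun s => 2 * inner ℝ (h s) (h' s))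
      (convex_Icc _ _) ?_ ?_ ?_
    · exact fun s hs => ((hd s hs).norm_sq).continuousWithinAt
    · exact fun s hs => ((hd s (interior_subset hs)).norm_sq).mono interior_subset
    · intro s hs
      have := hi s (interior_subset hs)
      linarith
  intro a ha b hb hab
  exact le_of_sq_le_sq (this ha hb hab) (norm_nonneg _)

/-- Every point `z` of the disk is the time `t` value of a solution of the Loewner equation. -/
lemma exists_isSolution_apply_eq {ζ : ℝ → Circle} (hζ : Continuous ζ) {t : ℝ} (ht : 0 ≤ t) {z : ℂ}
    (hz : ‖z‖ < 1) : ∃ w g, IsSolution ζ w t g ∧ g t = z := by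
  obtain ⟨R, hzR, hR1⟩ := exists_between hz
  have hR : 0 < R := (norm_nonneg z).trans_lt hzR
  set C : ℝ := 1 + 2 / (1 - R) ^ 2 with hC
  have hC0 : 0 ≤ C := by positivity
  -- The field precomposed with the retraction is bounded by `C * R` (it vanishes at `0`) and
  -- `2C`-Lipschitz on the whole plane, so one Picard–Lindelöf step covers all of `[0, t]`.
  have hpl : IsPicardLindelof (fun s x => -vectorField (ζ (t - s)) (radialRetraction R x))
      (⟨0, by simp [ht]⟩ : Icc (0 : ℝ) t) z (Real.toNNReal (C * R * t)) 0
      (Real.toNNReal (C * R)) (Real.toNNReal (C * 2)) := by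
    refine ⟨fun s _ => ?_, fun x _ => ?_, fun s _ x _ => ?_, ?_⟩
    · refine LipschitzOnWith.of_dist_le_mul fun x _ y _ => ?_
      rw [dist_neg_neg, dist_eq_norm, dist_eq_norm, Real.coe_toNNReal _ (by positivity), mul_assoc]
      refine (norm_vectorField_sub_le _ hR1 (norm_radialRetraction_le hR x)
        (norm_radialRetraction_le hR y)).trans ?_
      gcongr
      exact norm_radialRetraction_sub_le hR x y
    · have := continuous_vectorField (hζ.comp (continuous_const.sub continuous_id : Continuous
        fun s : ℝ => t - s)) ((norm_radialRetraction_le hR x).trans_lt hR1)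
      exact this.neg.continuousOn
    · rw [norm_neg, Real.coe_toNNReal _ (by positivity)]
      have := norm_vectorField_sub_le (ζ (t - s)) hR1 (norm_radialRetraction_le hR x)
        (w := 0) (by simpa using hR.le)
      rw [vectorField_zero, sub_zero, sub_zero] at this
      refine this.trans ?_
      gcongr
      exact norm_radialRetraction_le hR x
    · simp only [sub_zero, sub_self, NNReal.coe_zero]
      rw [max_eq_left ht, Real.coe_toNNReal _ (by positivity), Real.coe_toNNReal _ (by positivity)]
  obtain ⟨h, h0, hd⟩ := hpl.exists_eq_forall_mem_Icc_hasDerivWithinAt₀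
  simp only at h0
  -- In reversed time the field points inward, so the solution never leaves the disk of radius `R`
  -- and the truncation is inactive.
  have hanti : AntitoneOn (fun s => ‖h s‖) (Icc 0 t) := by
    refine antitoneOn_norm_of_inner_nonpos hd fun s _ => ?_
    rw [inner_neg_right, neg_nonpos]
    exact inner_vectorField_nonneg _ ((norm_radialRetraction_le hR _).trans_lt hR1)
      (R / max R ‖h s‖) (by positivity) _ rfl
  have hle : ∀ s ∈ Icc 0 t, ‖h s‖ ≤ R := fun s hs =>
    (hanti ⟨le_rfl, ht⟩ hs hs.1).trans ((congrArg norm h0).trans_le hzR.le)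
  refine ⟨h t, fun s => h (t - s), ⟨by simp, fun s hs => ?_⟩, by simp [h0]⟩
  have hs' : t - s ∈ Icc 0 t := ⟨by linarith [hs.2], by linarith [hs.1]⟩
  refine ⟨by simpa using (hle _ hs').trans_lt hR1, ?_⟩
  have hd' := hd _ hs'
  rw [radialRetraction_of_norm_le hR (hle _ hs'), sub_sub_cancel] at hd'
  have := HasDerivWithinAt.scomp (t' := Icc 0 t) (s := Icc 0 t) (h := fun s => t - s) s hd' (((hasDerivAt_id s).const_sub t).hasDerivWithinAt)
    (fun r hr => ⟨sub_nonneg.2 hr.2, sub_le_self t hr.1⟩)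
  simpa [Function.comp_def] using this

lemma IsSolution.monotoneOn_norm {ζ : ℝ → Circle} {z : ℂ} {t : ℝ} {g : ℝ → ℂ}
    (hg : IsSolution ζ z t g) : MonotoneOn (fun s => ‖g s‖) (Icc 0 t) := by
  have : MonotoneOn (fun s => ‖g s‖ ^ 2) (Icc 0 t) := by
    refine monotoneOn_of_hasDerivWithinAt_nonneg
      (f' := fun s => 2 * inner ℝ (g s) (vectorField (ζ s) (g s))) (convex_Icc _ _) ?_ ?_ ?_
    · exact fun s hs => ((hg.2 s hs).2.norm_sq).continuousWithinAt
    · exact fun s hs => ((hg.2 s (interior_subset hs)).2.norm_sq).mono interior_subset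
    · intro s hs
      have := inner_vectorField_nonneg (ζ s) (z := g s)
        (by simpa using (hg.2 s (interior_subset hs)).1) 1 zero_le_one (g s) (by simp)
      positivity
  intro a ha b hb hab
  exact le_of_sq_le_sq (this ha hb hab) (norm_nonneg _)

lemma IsSolution.norm_le {ζ : ℝ → Circle} {z : ℂ} {t : ℝ} {g : ℝ → ℂ}
    (hg : IsSolution ζ z t g) {s : ℝ} (hs : s ∈ Icc 0 t) : ‖g s‖ ≤ ‖g t‖ :=
  hg.monotoneOn_norm hs ⟨hs.1.trans hs.2, le_rfl⟩ hs.2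

/-- Norms increase along trajectories, so both solutions stay in the closed disk whose radius is the
larger terminal norm, where the field is Lipschitz. -/
lemma IsSolution.eqOn {ζ : ℝ → Circle} {z : ℂ} {t : ℝ} {g₁ g₂ : ℝ → ℂ}
    (h₁ : IsSolution ζ z t g₁) (h₂ : IsSolution ζ z t g₂) : EqOn g₁ g₂ (Icc 0 t) := by
  rcases lt_or_ge t 0 with ht | ht
  · simp [Icc_eq_empty (not_le.2 ht)]
  set R := max ‖g₁ t‖ ‖g₂ t‖ with hRdef
  have hR : R < 1 := max_lt (by simpa using (h₁.2 t ⟨ht, le_rfl⟩).1)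
    (by simpa using (h₂.2 t ⟨ht, le_rfl⟩).1)
  have hder : ∀ {g : ℝ → ℂ}, IsSolution ζ z t g → ∀ s ∈ Ico 0 t,
      HasDerivWithinAt g (vectorField (ζ s) (g s)) (Ici s) s := fun hg s hs =>
    (hg.2 s (Ico_subset_Icc_self hs)).2.mono_of_mem_nhdsWithin
      (mem_of_superset (Icc_mem_nhdsGE hs.2) (Icc_subset_Icc_left hs.1))
  refine ODE_solution_unique_of_mem_Icc_right (v := fun s => vectorField (ζ s))
    (s := fun _ => closedBall 0 R) (fun s _ => lipschitzOnWith_vectorField _ hR)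
    (fun s hs => (h₁.2 s hs).2.continuousWithinAt) (hder h₁) (fun s hs => ?_)
    (fun s hs => (h₂.2 s hs).2.continuousWithinAt) (hder h₂) (fun s hs => ?_)
    (h₁.1.trans h₂.1.symm)
  · rw [mem_closedBall_zero_iff]
    exact (h₁.norm_le (Ico_subset_Icc_self hs)).trans (le_max_left _ _)
  · rw [mem_closedBall_zero_iff]
    exact (h₂.norm_le (Ico_subset_Icc_self hs)).trans (le_max_right _ _)

/-- `f_t(z)` is the starting point of a solution that reaches `z` at time `t`. -/
lemma exists_isSolution_chain {ζ : ℝ → Circle} (hζ : Continuous ζ) {t : ℝ} (ht : 0 ≤ t) {z : ℂ}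
    (hz : ‖z‖ < 1) : ∃ g, IsSolution ζ (chain ζ t z) t g ∧ g t = z := by
  -- `chain` is an `invFunOn`, so surjectivity of the flow onto the disk is enough to make it a
  -- right inverse.
  have himg : ∃ w ∈ domain ζ t, flow ζ t w = z := by
    obtain ⟨w, g, hg, hgz⟩ := exists_isSolution_apply_eq hζ ht hz
    have hw : w ∈ domain ζ t := ⟨g, hg⟩
    refine ⟨w, hw, ?_⟩
    rw [flow, dif_pos hw, ← hgz]
    exact (Classical.choose_spec hw).eqOn hg ⟨ht, le_rfl⟩
  have hmem : chain ζ t z ∈ domain ζ t := Function.invFunOn_mem himg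
  have heq : flow ζ t (chain ζ t z) = z := Function.invFunOn_eq himg
  rw [flow, dif_pos hmem] at heq
  exact ⟨_, Classical.choose_spec hmem, heq⟩

end RadialLoewner

/-! ### Averaging and convergence of the Loewner chains. -/

namespace RadialLoewner

open Metric Set

/-- The powers of the driving functions average out to zero, uniformly on `[0, 1]`. -/
def AveragesOut {ι : Type*} (ζ : ι → ℝ → Circle) (l : Filter ι) : Prop :=
  ∀ n : ℤ, n ≠ 0 → ∀ ε > (0 : ℝ), ∀ᶠ i in l, ∀ t ∈ Icc (0 : ℝ) 1,
    ‖∫ s in (0 : ℝ)..t, (ζ i s : ℂ) ^ n‖ ≤ ε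

lemma continuous_circle_zpow {ζ : ℝ → Circle} (hζ : Continuous ζ) (n : ℤ) :
    Continuous fun s => (ζ s : ℂ) ^ n := by
  have h : Continuous fun s => ((ζ s ^ n : Circle) : ℂ) :=
    continuous_subtype_val.comp (hζ.zpow n)
  simpa only [Circle.coe_zpow] using h

/-- Integration by parts moves the derivative onto `φ`; the boundary term and the remaining integral
each cost `B * ε`. -/
lemma norm_integral_mul_le_of_norm_primitive_le {h φ φ' : ℝ → ℂ} {s ε B : ℝ} (hh : Continuous h)
    (hφ : ∀ u, HasDerivAt φ (φ' u) u) (hφ' : Continuous φ') (hs : s ∈ Icc (0 : ℝ) 1)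
    (hε : ∀ r ∈ Icc 0 s, ‖∫ u in (0 : ℝ)..r, h u‖ ≤ ε) (hB : ∀ r ∈ Icc 0 s, ‖φ r‖ ≤ B)
    (hB' : ∀ r ∈ Icc 0 s, ‖φ' r‖ ≤ B) : ‖∫ u in (0 : ℝ)..s, φ u * h u‖ ≤ 2 * B * ε := by
  have hB0 : 0 ≤ B := (norm_nonneg _).trans (hB 0 ⟨le_rfl, hs.1⟩)
  have hε0 : 0 ≤ ε := (norm_nonneg _).trans (hε 0 ⟨le_rfl, hs.1⟩)
  have hparts := intervalIntegral.integral_mul_deriv_eq_deriv_mul (a := 0) (b := s)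
    (fun u _ => hφ u) (v := fun r => ∫ u in (0 : ℝ)..r, h u)
    (fun u _ => hh.integral_hasStrictDerivAt 0 u |>.hasDerivAt)
    (hφ'.intervalIntegrable _ _) (hh.intervalIntegrable _ _)
  rw [hparts, intervalIntegral.integral_same, mul_zero, sub_zero]
  have h1 : ‖φ s * ∫ u in (0 : ℝ)..s, h u‖ ≤ B * ε := by
    rw [norm_mul]
    exact mul_le_mul (hB s ⟨hs.1, le_rfl⟩) (hε s ⟨hs.1, le_rfl⟩) (norm_nonneg _) hB0
  have h2 : ‖∫ u in (0 : ℝ)..s, φ' u * ∫ v in (0 : ℝ)..u, h v‖ ≤ B * ε := by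
    refine (intervalIntegral.norm_integral_le_of_norm_le_const (C := B * ε) fun u hu => ?_).trans ?_
    · rw [uIoc_of_le hs.1] at hu
      rw [norm_mul]
      exact mul_le_mul (hB' u ⟨hu.1.le, hu.2⟩) (hε u ⟨hu.1.le, hu.2⟩) (norm_nonneg _) hB0
    · rw [sub_zero, abs_of_nonneg hs.1]
      exact mul_le_of_le_one_right (by positivity) hs.2
  refine (norm_sub_le _ _).trans ?_
  linarith

/-- This is the geometric series in `z / ζ`, truncated. Every term of the sum carries a nonzero
power of `ζ`, which averaging kills. -/
lemma vectorField_sub_self_eq (ζ : Circle) {z : ℂ} (hz : ‖z‖ < 1) (N : ℕ) :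
    vectorField ζ z - z = (∑ n ∈ Finset.range N, 2 * (z ^ (n + 2) * (ζ : ℂ) ^ (-(n + 1 : ℤ)))) -
      2 * z ^ (N + 2) * (ζ : ℂ) ^ (-(N : ℤ)) / (z - ζ) := by
  have h := sub_circle_ne_zero ζ hz
  have hζ : (ζ : ℂ) ≠ 0 := Circle.coe_ne_zero ζ
  have hq : z / ζ - 1 ≠ 0 := by
    rw [div_sub_one hζ]
    exact div_ne_zero h hζ
  have hsum : (∑ n ∈ Finset.range N, 2 * (z ^ (n + 2) * (ζ : ℂ) ^ (-(n + 1 : ℤ)))) =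
      2 * z ^ 2 / ζ * (((z / ζ) ^ N - 1) / (z / ζ - 1)) := by
    rw [← geom_sum_eq (by simpa [sub_ne_zero] using hq), Finset.mul_sum]
    refine Finset.sum_congr rfl fun n _ => ?_
    rw [zpow_neg, zpow_add₀ hζ, zpow_one, zpow_natCast, div_pow, pow_add]
    field_simp
  rw [hsum, div_sub_one hζ, zpow_neg, zpow_natCast, vectorField, div_pow]
  field_simp
  ring

lemma norm_vectorField_remainder_le (ζ : Circle) {z : ℂ} {R : ℝ} (hR : R < 1) (hz : ‖z‖ ≤ R)
    (N : ℕ) : ‖2 * z ^ (N + 2) * (ζ : ℂ) ^ (-(N : ℤ)) / (z - ζ)‖ ≤ 2 * R ^ N / (1 - R) := by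
  have h1 : 0 < 1 - R := by linarith
  have h0 : 0 ≤ R := (norm_nonneg _).trans hz
  rw [norm_div, norm_mul, norm_mul, norm_pow, norm_zpow, Circle.norm_coe, one_zpow, mul_one,
    RCLike.norm_ofNat]
  have h2 : ‖z‖ ^ (N + 2) ≤ R ^ N := by
    rw [pow_add]
    calc ‖z‖ ^ N * ‖z‖ ^ 2 ≤ R ^ N * 1 := by
          gcongr
          exact pow_le_one₀ (norm_nonneg _) (hz.trans hR.le)
      _ = R ^ N := mul_one _
  gcongr
  exact one_sub_le_norm_sub ζ hz

lemma norm_exp_neg_mul_le {u : ℝ} (hu : 0 ≤ u) (z : ℂ) : ‖(Real.exp (-u) : ℂ) * z‖ ≤ ‖z‖ := by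
  rw [norm_mul, Complex.norm_real, Real.norm_of_nonneg (Real.exp_nonneg _)]
  exact mul_le_of_le_one_left (norm_nonneg _) (Real.exp_le_one_iff.2 (by linarith))

lemma hasDerivAt_exp_neg_mul (u : ℝ) (z : ℂ) :
    HasDerivAt (fun u : ℝ => (Real.exp (-u) : ℂ) * z) (-((Real.exp (-u) : ℂ) * z)) u := by
  have h := ((hasDerivAt_neg u).exp.ofReal_comp).mul_const z
  refine h.congr_deriv ?_
  push_cast
  ring

lemma continuous_exp_neg_mul (z : ℂ) : Continuous fun u : ℝ => (Real.exp (-u) : ℂ) * z := by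
  fun_prop

/-- The factor `2 * ε` arises because time reversal turns the primitive into a difference of two
primitives; `m + 1` bounds both the slowly varying factor and its derivative. -/
lemma norm_integral_exp_neg_mul_zpow_le {ζ : ℝ → Circle} (hζ : Continuous ζ) {z : ℂ}
    (hz : ‖z‖ ≤ 1) {ε t s : ℝ} (ht : t ≤ 1) (hs : s ∈ Icc 0 t) (m : ℕ) (n : ℤ)
    (hε : ∀ r ∈ Icc (0 : ℝ) 1, ‖∫ u in (0 : ℝ)..r, (ζ u : ℂ) ^ n‖ ≤ ε) :
    ‖∫ u in (0 : ℝ)..s, ((Real.exp (-u) : ℂ) * z) ^ m * (ζ (t - u) : ℂ) ^ n‖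
      ≤ 2 * (m + 1) * (2 * ε) := by
  have hpow : ∀ r ∈ Icc 0 s, ‖((Real.exp (-r) : ℂ) * z) ^ m‖ ≤ 1 := fun r hr => by
    rw [norm_pow]
    exact pow_le_one₀ (norm_nonneg _) ((norm_exp_neg_mul_le hr.1 z).trans hz)
  have hc := continuous_circle_zpow hζ n
  refine norm_integral_mul_le_of_norm_primitive_le
    (φ' := fun u => -(m * ((Real.exp (-u) : ℂ) * z) ^ m))
    (hc.comp (continuous_const.sub continuous_id)) (fun u => ?_)
    ((((continuous_exp_neg_mul z).pow m).const_mul _).neg) ⟨hs.1, hs.2.trans ht⟩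
    (fun r hr => ?_) (fun r hr => ?_) (fun r hr => ?_)
  · rcases m with _ | m
    · simpa using hasDerivAt_const u (1 : ℂ)
    · refine ((hasDerivAt_exp_neg_mul u z).pow (m + 1)).congr_deriv ?_
      simp only [Nat.add_sub_cancel]
      ring
  · have hi : ∀ a b : ℝ, IntervalIntegrable (fun u => (ζ u : ℂ) ^ n) volume a b :=
      fun a b => hc.intervalIntegrable a b
    change ‖∫ u in (0 : ℝ)..r, (ζ (t - u) : ℂ) ^ n‖ ≤ 2 * ε
    rw [intervalIntegral.integral_comp_sub_left (fun u => (ζ u : ℂ) ^ n), sub_zero,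
      ← intervalIntegral.integral_interval_sub_left (hi 0 t) (hi 0 (t - r))]
    have hr' := hr.2.trans hs.2
    have h1 := hε t ⟨hr.1.trans hr', ht⟩
    have h2 := hε (t - r) ⟨by linarith, by linarith [hr.1]⟩
    exact (norm_sub_le _ _).trans (by linarith)
  · exact (hpow r hr).trans (by linarith [(Nat.cast_nonneg m : (0 : ℝ) ≤ m)])
  · rw [norm_neg, norm_mul, Complex.norm_natCast]
    have := mul_le_mul_of_nonneg_left (hpow r hr) (Nat.cast_nonneg m : (0 : ℝ) ≤ m)
    linarith

lemma continuous_vectorField_exp_neg_mul {ζ : ℝ → Circle} (hζ : Continuous ζ) {z : ℂ}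
    (hz : ‖z‖ < 1) (t : ℝ) : ContinuousOn
      (fun u => vectorField (ζ (t - u)) ((Real.exp (-u) : ℂ) * z) - (Real.exp (-u) : ℂ) * z)
      (Ici 0) := by
  have h : ∀ u ∈ Ici (0 : ℝ), (Real.exp (-u) : ℂ) * z - (ζ (t - u) : ℂ) ≠ 0 := fun u hu =>
    sub_circle_ne_zero _ ((norm_exp_neg_mul_le hu z).trans_lt hz)
  have h' : Continuous fun u => (ζ (t - u) : ℂ) :=
    continuous_subtype_val.comp (hζ.comp (continuous_const.sub continuous_id))
  have h'' := continuous_exp_neg_mul z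
  unfold vectorField
  exact (h''.continuousOn.neg.mul ((h''.add h').continuousOn.div (h''.sub h').continuousOn h)).sub
    h''.continuousOn

lemma norm_integral_vectorField_sub_le {ζ : ℝ → Circle} (hζ : Continuous ζ) {z : ℂ} {R : ℝ}
    (hR : R < 1) (hz : ‖z‖ ≤ R) {ε t s : ℝ} (ht : t ≤ 1) (hs : s ∈ Icc 0 t) (N : ℕ)
    (hε : ∀ n < N, ∀ r ∈ Icc (0 : ℝ) 1, ‖∫ u in (0 : ℝ)..r, (ζ u : ℂ) ^ (-(n + 1 : ℤ))‖ ≤ ε) :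
    ‖∫ u in (0 : ℝ)..s,
        (vectorField (ζ (t - u)) ((Real.exp (-u) : ℂ) * z) - (Real.exp (-u) : ℂ) * z)‖
      ≤ (∑ n ∈ Finset.range N, 8 * ((n : ℝ) + 3)) * ε + 2 * R ^ N / (1 - R) := by
  have hz1 : ‖z‖ < 1 := hz.trans_lt hR
  have h0 : 0 ≤ R := (norm_nonneg _).trans hz
  set F : ℝ → ℂ := fun u => ∑ n ∈ Finset.range N,
    2 * (((Real.exp (-u) : ℂ) * z) ^ (n + 2) * (ζ (t - u) : ℂ) ^ (-(n + 1 : ℤ))) with hF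
  have hc : ∀ n : ℕ, Continuous fun u =>
      ((Real.exp (-u) : ℂ) * z) ^ (n + 2) * (ζ (t - u) : ℂ) ^ (-(n + 1 : ℤ)) := fun n =>
    ((continuous_exp_neg_mul z).pow _).mul
      ((continuous_circle_zpow hζ _).comp (continuous_const.sub continuous_id))
  have hFc : Continuous F := continuous_finsetSum _ fun n _ => (hc n).const_mul _
  have hGc : ContinuousOn
      (fun u => vectorField (ζ (t - u)) ((Real.exp (-u) : ℂ) * z) - (Real.exp (-u) : ℂ) * z)
      (uIcc 0 s) := (continuous_vectorField_exp_neg_mul hζ hz1 t).mono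
    (by rw [uIcc_of_le hs.1]; exact Icc_subset_Ici_self)
  have hsplit := intervalIntegral.integral_sub hGc.intervalIntegrable
    (hFc.intervalIntegrable (μ := volume) 0 s)
  rw [eq_sub_iff_add_eq] at hsplit
  rw [← hsplit, add_comm]
  refine (norm_add_le _ _).trans (add_le_add ?_ ?_)
  · rw [intervalIntegral.integral_finsetSum fun n _ =>
      ((hc n).const_mul _).intervalIntegrable _ _, Finset.sum_mul]
    refine norm_sum_le_of_le _ fun n hn => ?_
    rw [intervalIntegral.integral_const_mul, norm_mul, RCLike.norm_ofNat]
    have := norm_integral_exp_neg_mul_zpow_le hζ hz1.le ht hs (n + 2) _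
      (hε n (Finset.mem_range.1 hn))
    push_cast at this ⊢
    linarith
  · have hC : 0 ≤ 2 * R ^ N / (1 - R) := by
      have : 0 < 1 - R := by linarith
      positivity
    refine (intervalIntegral.norm_integral_le_of_norm_le_const (C := 2 * R ^ N / (1 - R))
      fun u hu => ?_).trans ?_
    · rw [uIoc_of_le hs.1] at hu
      have hk := norm_exp_neg_mul_le hu.1.le z
      rw [vectorField_sub_self_eq _ (hk.trans_lt hz1) N, hF, sub_sub_cancel_left, norm_neg]
      exact norm_vectorField_remainder_le _ hR (hk.trans hz) N
    · rw [sub_zero, abs_of_nonneg hs.1]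
      exact mul_le_of_le_one_right hC (hs.2.trans ht)

lemma norm_chain_sub_le {ζ : ℝ → Circle} (hζ : Continuous ζ) {z : ℂ} {R : ℝ}
    (hR : R < 1) (hz : ‖z‖ ≤ R) {δ t : ℝ} (ht0 : 0 ≤ t) (ht : t ≤ 1)
    (hδ : ∀ s ∈ Icc 0 t, ‖∫ u in (0 : ℝ)..s,
      (vectorField (ζ (t - u)) ((Real.exp (-u) : ℂ) * z) - (Real.exp (-u) : ℂ) * z)‖ ≤ δ) :
    ‖chain ζ t z - (Real.exp (-t) : ℂ) * z‖ ≤ Real.exp (1 + 2 / (1 - R) ^ 2) * δ := by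
  have hz1 : ‖z‖ < 1 := hz.trans_lt hR
  obtain ⟨g, hg, hgz⟩ := exists_isSolution_chain hζ ht0 hz1
  set C : ℝ := 1 + 2 / (1 - R) ^ 2 with hC
  have hC0 : 0 < C := by positivity
  set k : ℝ → ℂ := fun u => (Real.exp (-u) : ℂ) * z with hk
  set E : ℝ → ℂ := fun s => ∫ u in (0 : ℝ)..s, (vectorField (ζ (t - u)) (k u) - k u) with hE
  -- Adding `E` cancels the fluctuation along `k`: the derivative of `D` is a difference of one
  -- field at two points, so `‖D'‖ ≤ C (‖D‖ + δ)`.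
  set D : ℝ → ℂ := fun s => g (t - s) - k s + E s with hD
  have hrev : ∀ s ∈ Icc 0 t, t - s ∈ Icc 0 t := fun s hs =>
    ⟨by linarith [hs.2], by linarith [hs.1]⟩
  have hgd : ∀ s ∈ Icc 0 t, HasDerivWithinAt (fun s => g (t - s))
      (-vectorField (ζ (t - s)) (g (t - s))) (Icc 0 t) s := fun s hs => by
    have := HasDerivWithinAt.scomp (t' := Icc 0 t) (s := Icc 0 t) (h := fun s => t - s) s
      (hg.2 _ (hrev s hs)).2 (((hasDerivAt_id s).const_sub t).hasDerivWithinAt)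
      (fun r hr => hrev r hr)
    simpa [Function.comp_def] using this
  have hcont : ContinuousOn (fun u => vectorField (ζ (t - u)) (k u) - k u) (Icc 0 t) :=
    (continuous_vectorField_exp_neg_mul hζ hz1 t).mono Icc_subset_Ici_self
  have hEd : ∀ s ∈ Icc 0 t, HasDerivWithinAt E (vectorField (ζ (t - s)) (k s) - k s)
      (Icc 0 t) s := fun s hs => by
    have : Fact (s ∈ Icc 0 t) := ⟨hs⟩
    refine intervalIntegral.integral_hasDerivWithinAt_right (t := Icc 0 t)
      ((hcont.mono ?_).intervalIntegrable) ?_ (hcont s hs)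
    · rw [uIcc_of_le hs.1]
      exact Icc_subset_Icc_right hs.2
    · exact hcont.stronglyMeasurableAtFilter_nhdsWithin measurableSet_Icc s
  have hDd : ∀ s ∈ Icc 0 t, HasDerivWithinAt D
      (-(vectorField (ζ (t - s)) (g (t - s)) - vectorField (ζ (t - s)) (k s))) (Icc 0 t) s :=
    fun s hs => by
    refine HasDerivWithinAt.congr_deriv
      (((hgd s hs).sub (hasDerivAt_exp_neg_mul s z).hasDerivWithinAt).add (hEd s hs)) ?_
    simp only [hk]
    ring
  have hbound := norm_le_gronwallBound_of_norm_deriv_right_le (f := D) (δ := 0) (K := C)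
    (ε := C * δ) (a := 0) (b := t) (fun s hs => (hDd s hs).continuousWithinAt)
    (fun s hs => (hDd s (Ico_subset_Icc_self hs)).mono_of_mem_nhdsWithin
      (mem_of_superset (Icc_mem_nhdsGE hs.2) (Icc_subset_Icc_left hs.1)))
    (by simp [hD, hE, hk, hgz]) (fun s hs => ?_) t ⟨ht0, le_rfl⟩
  · rw [gronwallBound_of_K_ne_0 hC0.ne', sub_zero] at hbound
    beta_reduce at hbound
    rw [zero_mul, zero_add, mul_div_cancel_left₀ _ hC0.ne'] at hbound
    have hEt : ‖E t‖ ≤ δ := hδ t ⟨ht0, le_rfl⟩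
    have hδ0 : 0 ≤ δ := (norm_nonneg _).trans hEt
    have heq : chain ζ t z - k t = D t - E t := by
      simp [hD, hg.1]
    calc ‖chain ζ t z - k t‖ = ‖D t - E t‖ := by rw [heq]
      _ ≤ ‖D t‖ + ‖E t‖ := norm_sub_le _ _
      _ ≤ δ * (Real.exp (C * t) - 1) + δ := add_le_add hbound hEt
      _ = Real.exp (C * t) * δ := by ring
      _ ≤ Real.exp C * δ := by
        gcongr
        exact mul_le_of_le_one_right hC0.le ht
  · have hs' := Ico_subset_Icc_self hs
    rw [norm_neg]
    have h1 := norm_vectorField_sub_le (ζ (t - s)) hR (z := g (t - s)) (w := k s)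
      ((hg.norm_le (hrev s hs')).trans (by rwa [hgz])) ((norm_exp_neg_mul_le hs.1 z).trans hz)
    have h2 : ‖g (t - s) - k s‖ ≤ ‖D s‖ + δ := by
      have : g (t - s) - k s = D s - E s := by simp [hD]
      rw [this]
      exact (norm_sub_le _ _).trans (add_le_add le_rfl (hδ s hs'))
    calc _ ≤ C * ‖g (t - s) - k s‖ := h1
      _ ≤ C * (‖D s‖ + δ) := by gcongr
      _ = C * ‖D s‖ + C * δ := by ring

/-- If the driving functions average out, then the Loewner chains converge to the chain
`z ↦ e⁻ᵗ z` of concentric disks. -/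
theorem AveragesOut.tendstoCaratheodory {ι : Type*} {ζ : ι → ℝ → Circle} {l : Filter ι}
    (hζ : ∀ i, Continuous (ζ i)) (h : AveragesOut ζ l) :
    TendstoCaratheodory (fun i => chain (ζ i)) l (fun t z => (Real.exp (-t) : ℂ) * z) := by
  intro K hK hKsub
  obtain ⟨R, hR1, hKR⟩ : ∃ R < 1, ∀ p ∈ K, ‖p.1‖ ≤ R := by
    rcases K.eq_empty_or_nonempty with rfl | hne
    · exact ⟨0, zero_lt_one, by simp⟩
    · obtain ⟨p, hp, hmax⟩ := hK.exists_isMaxOn hne (f := fun p : ℂ × ℝ => ‖p.1‖)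
        (by fun_prop)
      exact ⟨‖p.1‖, by simpa using (hKsub hp).1, fun q hq => hmax hq⟩
  rcases K.eq_empty_or_nonempty with rfl | ⟨p₀, hp₀⟩
  · exact tendstoUniformlyOn_empty
  have hR0 : 0 ≤ R := (norm_nonneg _).trans (hKR p₀ hp₀)
  have h1R : 0 < 1 - R := by linarith
  rw [Metric.tendstoUniformlyOn_iff]
  intro η hη
  set M := Real.exp (1 + 2 / (1 - R) ^ 2) with hM
  have hM0 : 0 < M := Real.exp_pos _
  have hlim : Tendsto (fun N : ℕ => M * (2 * R ^ N / (1 - R))) atTop (𝓝 (M * (2 * 0 / (1 - R)))) :=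
    (((tendsto_pow_atTop_nhds_zero_of_lt_one hR0 hR1).const_mul 2).div_const _).const_mul M
  rw [mul_zero, zero_div, mul_zero] at hlim
  obtain ⟨N, hN⟩ := (hlim.eventually (gt_mem_nhds (half_pos hη))).exists
  set S : ℝ := ∑ n ∈ Finset.range N, 8 * ((n : ℝ) + 3) with hS
  have hS0 : 0 ≤ S := Finset.sum_nonneg fun n _ => by positivity
  -- `N` makes the series tail cost less than `η / 2`. Using `S + 1` avoids division by zero and
  -- makes the other half strict.
  set ε : ℝ := η / (2 * M * (S + 1)) with hε
  have hε0 : 0 < ε := by positivity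
  have hev : ∀ᶠ i in l, ∀ n ∈ Finset.range N, ∀ r ∈ Icc (0 : ℝ) 1,
      ‖∫ u in (0 : ℝ)..r, (ζ i u : ℂ) ^ (-(n + 1 : ℤ))‖ ≤ ε :=
    (Filter.eventually_all_finset _).2 fun n _ => h _ (by omega) ε hε0
  filter_upwards [hev] with i hi p hp
  obtain ⟨hp1, hp2⟩ := hKsub hp
  rw [dist_comm, dist_eq_norm]
  refine (norm_chain_sub_le (hζ i) hR1 (hKR p hp) hp2.1 hp2.2 fun s hs =>
    norm_integral_vectorField_sub_le (hζ i) hR1 (hKR p hp) hp2.2 hs N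
      fun n hn => hi n (Finset.mem_range.2 hn)).trans_lt ?_
  have hSε : M * (S * ε) < η / 2 := by
    have : M * ((S + 1) * ε) = η / 2 := by
      rw [hε]
      field_simp
    rw [← this]
    gcongr
    linarith
  rw [← hM, ← hS, mul_add]
  linarith

end RadialLoewner

/-! ### Weak convergence of the driving measures. -/

namespace RadialLoewner

open Set BoundedContinuousFunction

/-- The monomial `(ζ, t) ↦ ζⁿ tᵐ` on `S¹ × [0, 1]`. -/
noncomputable def monomial (p : ℤ × ℕ) : (Circle × unitInterval) →ᵇ ℂ :=
  BoundedContinuousFunction.mkOfCompact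
    ⟨fun x => ((x.1 ^ p.1 : Circle) : ℂ) * ((x.2 : ℝ) : ℂ) ^ p.2, by
      have h : Continuous fun x : Circle × unitInterval => x.1 ^ p.1 := continuous_fst.zpow p.1
      have h' : Continuous fun x : Circle × unitInterval => ((x.1 ^ p.1 : Circle) : ℂ) :=
        continuous_subtype_val.comp h
      fun_prop⟩

lemma monomial_apply (p : ℤ × ℕ) (x : Circle × unitInterval) :
    monomial p x = (x.1 : ℂ) ^ p.1 * ((x.2 : ℝ) : ℂ) ^ p.2 := by
  rw [← Circle.coe_zpow]
  rfl

/-- The star subalgebra generated by the monomials `ζⁿ tᵐ`. -/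
noncomputable def monomialSubalgebra : StarSubalgebra ℂ ((Circle × unitInterval) →ᵇ ℂ) where
  toSubalgebra := Algebra.adjoin ℂ (range monomial)
  star_mem' := by
    change Algebra.adjoin ℂ (range monomial) ≤ star (Algebra.adjoin ℂ (range monomial))
    refine Algebra.adjoin_le ?_
    rintro - ⟨p, rfl⟩
    refine Algebra.subset_adjoin ⟨(-p.1, p.2), BoundedContinuousFunction.ext fun x => ?_⟩
    rw [BoundedContinuousFunction.star_apply, monomial_apply, monomial_apply]
    simp [← Circle.coe_inv_eq_conj]

/-- Monomials contain `1` and are closed under products, so their linear span is already the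
algebra. Convergence then only has to be checked on monomials. -/
lemma mem_span_of_mem_monomialSubalgebra {f : (Circle × unitInterval) →ᵇ ℂ}
    (hf : f ∈ monomialSubalgebra) : f ∈ Submodule.span ℂ (range monomial) := by
  have h : Subalgebra.toSubmodule (Algebra.adjoin ℂ (range monomial))
      = Submodule.span ℂ (range monomial) := by
    refine Algebra.adjoin_eq_span_of_subset ℂ (Subset.trans ?_ Submodule.subset_span)
    intro x hx
    refine Submonoid.closure_induction (fun _ => id) ⟨0, ?_⟩ ?_ hx
    · ext x
      simp [monomial_apply]
    · rintro - - - - ⟨p, rfl⟩ ⟨q, rfl⟩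
      refine ⟨p + q, BoundedContinuousFunction.ext fun x => ?_⟩
      rw [BoundedContinuousFunction.mul_apply, monomial_apply, monomial_apply, monomial_apply,
        Prod.fst_add, Prod.snd_add, zpow_add₀ (Circle.coe_ne_zero _), pow_add]
      ring
  rw [← h]
  exact hf

lemma separatesPoints_monomialSubalgebra :
    (monomialSubalgebra.map (toContinuousMapStarₐ ℂ)).SeparatesPoints := by
  have hmem : ∀ p, monomial p ∈ monomialSubalgebra := fun p => Algebra.subset_adjoin ⟨p, rfl⟩
  rintro ⟨z, s⟩ ⟨w, t⟩ hne
  by_cases hzw : z = w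
  · refine ⟨_, ⟨_, ⟨_, hmem (0, 1), rfl⟩, rfl⟩, ?_⟩
    change monomial (0, 1) (z, s) ≠ monomial (0, 1) (w, t)
    simp only [monomial_apply, zpow_zero, pow_one, one_mul, ne_eq, Complex.ofReal_inj]
    exact fun h => hne (Prod.ext hzw (Subtype.ext h))
  · refine ⟨_, ⟨_, ⟨_, hmem (1, 0), rfl⟩, rfl⟩, ?_⟩
    change monomial (1, 0) (z, s) ≠ monomial (1, 0) (w, t)
    simp only [monomial_apply, zpow_one, pow_zero, mul_one, ne_eq]
    exact fun h => hzw (Circle.ext h)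

lemma integral_unitInterval_eq (f : ℝ → ℂ) :
    ∫ t : unitInterval, f t = ∫ t in (0 : ℝ)..1, f t := by
  rw [intervalIntegral.integral_of_le zero_le_one, ← integral_Icc_eq_integral_Ioc]
  exact integral_subtype measurableSet_Icc f

lemma integral_monomial_drivingMeasure {ζ : ℝ → Circle} (hζ : Continuous ζ) (p : ℤ × ℕ) :
    ∫ x, monomial p x ∂(drivingMeasure ζ hζ : Measure (Circle × unitInterval))
      = ∫ t in (0 : ℝ)..1, (t : ℂ) ^ p.2 * (ζ t : ℂ) ^ p.1 := by
  have hc : Continuous fun t : unitInterval => (ζ t, t) := by fun_prop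
  have hmap : (drivingMeasure ζ hζ : Measure (Circle × unitInterval))
      = Measure.map (fun t : unitInterval => (ζ t, t)) volume := rfl
  rw [hmap, integral_map hc.measurable.aemeasurable (monomial p).continuous.aestronglyMeasurable,
    ← integral_unitInterval_eq]
  refine integral_congr_ae (Eventually.of_forall fun t => ?_)
  simp only [monomial_apply]
  ring

lemma integral_zpow_uniformCircle {n : ℤ} (hn : n ≠ 0) :
    ∫ z : Circle, (z : ℂ) ^ n ∂uniformCircle = 0 := by
  have hc : Continuous fun z : Circle => (z : ℂ) ^ n := by
    simp only [← Circle.coe_zpow]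
    exact continuous_subtype_val.comp (continuous_zpow n)
  have h2π : (0 : ℝ) ≤ 2 * Real.pi := by positivity
  rw [uniformCircle, integral_smul_measure,
    integral_map Circle.exp.continuous.measurable.aemeasurable hc.aestronglyMeasurable,
    ← intervalIntegral.integral_of_le h2π]
  have hni : (n : ℂ) * Complex.I ≠ 0 := mul_ne_zero (Int.cast_ne_zero.2 hn) Complex.I_ne_zero
  have h : ∀ θ : ℝ, ((Circle.exp θ : Circle) : ℂ) ^ n = Complex.exp (n * Complex.I * θ) := by
    intro θ
    rw [Circle.coe_exp, ← Complex.exp_int_mul]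
    ring_nf
  simp only [h]
  rw [integral_exp_mul_complex hni]
  have : Complex.exp (n * Complex.I * (2 * Real.pi : ℝ)) = 1 := by
    rw [Complex.exp_eq_one_iff]
    exact ⟨n, by push_cast; ring⟩
  rw [this]
  simp

lemma integral_monomial_uniformMeasure (p : ℤ × ℕ) :
    ∫ x, monomial p x ∂(uniformMeasure : Measure (Circle × unitInterval))
      = if p.1 = 0 then ∫ t in (0 : ℝ)..1, (t : ℂ) ^ p.2 else 0 := by
  have h : ∫ x, monomial p x ∂(uniformMeasure : Measure (Circle × unitInterval))
      = (∫ z : Circle, (z : ℂ) ^ p.1 ∂uniformCircle) * ∫ t : unitInterval, ((t : ℝ) : ℂ) ^ p.2 := by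
    simp only [monomial_apply]
    exact integral_prod_mul (fun z : Circle => (z : ℂ) ^ p.1)
      (fun t : unitInterval => ((t : ℝ) : ℂ) ^ p.2)
  rw [h]
  split_ifs with hp
  · rw [hp, ← integral_unitInterval_eq (fun t => (t : ℂ) ^ p.2)]
    simp
  · rw [integral_zpow_uniformCircle hp, zero_mul]

/-- For `n = 0` the two integrals agree exactly, both time marginals being Lebesgue; otherwise the
limit is zero and integration by parts against `tᵐ` applies. -/
lemma AveragesOut.tendsto_integral_monomial {ι : Type*} {ζ : ι → ℝ → Circle} {l : Filter ι}
    (hζ : ∀ i, Continuous (ζ i)) (h : AveragesOut ζ l) (p : ℤ × ℕ) :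
    Tendsto (fun i => ∫ x, monomial p x ∂(drivingMeasure (ζ i) (hζ i) : Measure _)) l
      (𝓝 (∫ x, monomial p x ∂(uniformMeasure : Measure _))) := by
  obtain ⟨n, m⟩ := p
  simp only [integral_monomial_drivingMeasure, integral_monomial_uniformMeasure]
  split_ifs with hn
  · simp only [hn, zpow_zero, mul_one]
    exact tendsto_const_nhds
  · rw [Metric.tendsto_nhds]
    intro η hη
    have hm : (0 : ℝ) < 2 * (m + 1) := by positivity
    filter_upwards [h n hn (η / 2 / (2 * (m + 1))) (by positivity)] with i hi
    rw [dist_zero_right]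
    have hpow : ∀ k : ℕ, ∀ r ∈ Icc (0 : ℝ) 1, ‖(r : ℂ) ^ k‖ ≤ 1 := fun k r hr => by
      rw [norm_pow, Complex.norm_real, Real.norm_of_nonneg hr.1]
      exact pow_le_one₀ hr.1 hr.2
    refine (norm_integral_mul_le_of_norm_primitive_le (B := m + 1)
      (φ' := fun u => (m : ℂ) * (u : ℂ) ^ (m - 1)) (continuous_circle_zpow (hζ i) n)
      (fun u => ?_) (by fun_prop) ⟨zero_le_one, le_rfl⟩ hi (fun r hr => ?_)
      (fun r hr => ?_)).trans_lt ?_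
    · exact ((Complex.ofRealCLM.hasDerivAt (x := u)).pow m).congr_deriv (by simp)
    · exact (hpow m r hr).trans (by linarith [(Nat.cast_nonneg m : (0 : ℝ) ≤ m)])
    · rw [norm_mul, Complex.norm_natCast]
      have := mul_le_mul_of_nonneg_left (hpow (m - 1) r hr) (Nat.cast_nonneg m : (0 : ℝ) ≤ m)
      linarith
    · rw [mul_div_cancel₀ _ hm.ne']
      exact half_lt_self hη

/-- If the driving functions average out, then the driving measures converge weakly to the uniform
measure. -/
theorem AveragesOut.tendsto_drivingMeasure {ι : Type*} {ζ : ι → ℝ → Circle} {l : Filter ι}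
    (hζ : ∀ i, Continuous (ζ i)) (h : AveragesOut ζ l) :
    Tendsto (fun i => drivingMeasure (ζ i) (hζ i)) l (𝓝 uniformMeasure) := by
  -- Tightness is automatic on a compact space, so a point-separating star algebra of test functions
  -- suffices.
  refine ProbabilityMeasure.tendsto_of_tight_of_separatesPoints ℂ .of_compactSpace
    separatesPoints_monomialSubalgebra fun g hg => ?_
  refine Submodule.span_induction (p := fun g _ => Tendsto
    (fun i => ∫ x, g x ∂(drivingMeasure (ζ i) (hζ i) : Measure (Circle × unitInterval))) l
    (𝓝 (∫ x, g x ∂(uniformMeasure : Measure (Circle × unitInterval)))))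
    ?_ ?_ ?_ ?_ (mem_span_of_mem_monomialSubalgebra hg)
  · rintro - ⟨p, rfl⟩
    exact h.tendsto_integral_monomial hζ p
  · simp only [BoundedContinuousFunction.coe_zero, Pi.zero_apply, integral_zero]
    exact tendsto_const_nhds
  · intro f g _ _ hf hg
    simp only [BoundedContinuousFunction.add_apply]
    simpa only [integral_add (f.integrable _) (g.integrable _)] using hf.add hg
  · intro c f _ hf
    simp only [BoundedContinuousFunction.smul_apply, integral_smul]
    exact hf.const_smul c

end RadialLoewner

/-! ### Almost sure averaging of circular Brownian motion. -/

namespace RadialLoewner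

open Set

lemma continuous_circularPath {Ω : Type*} {W : ℝ≥0 → Ω → ℝ} {ω : Ω} (hω : Continuous fun t => W t ω) (κ : ℝ) :
    Continuous (circularPath W κ ω) := by
  unfold circularPath
  have h : Continuous fun t : ℝ => W (Real.toNNReal (κ * t)) ω :=
    hω.comp (continuous_real_toNNReal.comp (continuous_const.mul continuous_id))
  exact Circle.exp.continuous.comp h

lemma circularPath_zpow {Ω : Type*} (W : ℝ≥0 → Ω → ℝ) (κ : ℝ) (ω : Ω) (t : ℝ) (n : ℤ) :
    (circularPath W κ ω t : ℂ) ^ n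
      = Complex.exp ((n : ℝ) * (W (Real.toNNReal (κ * t)) ω : ℝ) * Complex.I) := by
  rw [circularPath, Circle.coe_exp, ← Complex.exp_int_mul]
  push_cast
  ring_nf

lemma norm_exp_mul_I (c x : ℝ) : ‖Complex.exp (c * x * Complex.I)‖ = 1 := by
  rw [← Complex.ofReal_mul, Complex.norm_exp_ofReal_mul_I]

lemma exists_norm_integral_le_of_tendsto_sq {e : ℝ → ℂ} (he : Continuous e) (hb : ∀ u, ‖e u‖ ≤ 1)
    (h : Tendsto (fun k : ℕ => ‖∫ u in (0 : ℝ)..(k : ℝ) ^ 2, e u‖ / (k : ℝ) ^ 2) atTop (𝓝 0))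
    {ε : ℝ} (hε : 0 < ε) : ∃ T₀ > 0, ∀ T ≥ T₀, ‖∫ u in (0 : ℝ)..T, e u‖ ≤ ε * T := by
  obtain ⟨k₀, hk₀⟩ := eventually_atTop.1 (h.eventually (gt_mem_nhds (half_pos hε)))
  -- `k₀ + 1` forces `⌊√T⌋ ≥ k₀` and `⌊√T⌋ ≥ 1`; `6 / ε` makes the gap `T - k² ≤ 3√T` at most `ε T /
  -- 2`.
  set s₀ : ℝ := max (k₀ + 1) (6 / ε) with hs₀
  have hs₀1 : (k₀ : ℝ) + 1 ≤ s₀ := le_max_left _ _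
  have hs₀pos : 0 < s₀ := lt_of_lt_of_le (by positivity) hs₀1
  refine ⟨s₀ ^ 2, by positivity, fun T hT => ?_⟩
  have hT0 : 0 ≤ T := (sq_nonneg _).trans hT
  set s := Real.sqrt T with hs
  have hsT : s ^ 2 = T := Real.sq_sqrt hT0
  have hs0 : s₀ ≤ s := Real.le_sqrt_of_sq_le hT
  have hspos : 0 < s := hs₀pos.trans_le hs0
  set k := ⌊s⌋₊ with hk
  have hk1 : (k : ℝ) ≤ s := Nat.floor_le hspos.le
  have hk2 : s < k + 1 := Nat.lt_floor_add_one s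
  have hkk : k₀ ≤ k := Nat.le_floor (by linarith)
  have hkpos : (0 : ℝ) < k := by
    have : (0 : ℝ) ≤ k₀ := Nat.cast_nonneg _
    linarith
  have hS := hk₀ k hkk
  rw [div_lt_iff₀ (by positivity)] at hS
  have hsplit := intervalIntegral.integral_add_adjacent_intervals (μ := volume)
    (he.intervalIntegrable 0 ((k : ℝ) ^ 2)) (he.intervalIntegrable ((k : ℝ) ^ 2) T)
  have hrest : ‖∫ u in (k : ℝ) ^ 2..T, e u‖ ≤ T - (k : ℝ) ^ 2 := by
    refine (intervalIntegral.norm_integral_le_of_norm_le_const (C := 1)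
      fun u _ => hb u).trans ?_
    rw [one_mul, abs_of_nonneg]
    nlinarith
  have h6 : 6 ≤ ε * s := by
    have : 6 / ε ≤ s := (le_max_right _ _).trans hs0
    rwa [div_le_iff₀ hε, mul_comm] at this
  rw [← hsplit]
  refine (norm_add_le _ _).trans ?_
  have h7 : T - (k : ℝ) ^ 2 ≤ 3 * s := by
    have : (k : ℝ) ≥ 1 := by
      have : 1 ≤ k := Nat.cast_pos.1 hkpos
      exact_mod_cast this
    nlinarith
  have h8 : ε / 2 * (k : ℝ) ^ 2 ≤ ε / 2 * T := by
    gcongr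
    nlinarith
  have h9 : 3 * s ≤ ε / 2 * T := by
    rw [← hsT]
    nlinarith
  linarith

lemma averagesOut_circularPath_of_tendsto_sq {Ω : Type*} {W : ℝ≥0 → Ω → ℝ} {ω : Ω}
    (hω : Continuous fun t => W t ω)
    (h : ∀ n : ℤ, n ≠ 0 → Tendsto (fun k : ℕ => ‖∫ u in (0 : ℝ)..(k : ℝ) ^ 2,
      Complex.exp ((n : ℝ) * (W u.toNNReal ω : ℝ) * Complex.I)‖ / (k : ℝ) ^ 2) atTop (𝓝 0)) :
    AveragesOut (fun κ : ℝ => circularPath W κ ω) atTop := by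
  intro n hn ε hε
  have hcW : Continuous fun u : ℝ => W u.toNNReal ω := hω.comp continuous_real_toNNReal
  set e : ℝ → ℂ := fun u => Complex.exp ((n : ℝ) * (W u.toNNReal ω : ℝ) * Complex.I) with he
  have hec : Continuous e := by fun_prop
  have heb : ∀ u, ‖e u‖ ≤ 1 := fun u => (norm_exp_mul_I _ _).le
  obtain ⟨T₀, hT₀, hT⟩ := exists_norm_integral_le_of_tendsto_sq hec heb (h n hn) hε
  filter_upwards [eventually_ge_atTop (T₀ / ε), eventually_gt_atTop 0] with κ hκ hκ0 t ht
  simp only [circularPath_zpow]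
  have hscale := intervalIntegral.integral_comp_mul_left (a := 0) (b := t) e hκ0.ne'
  rw [mul_zero] at hscale
  change ‖∫ s in (0 : ℝ)..t, e (κ * s)‖ ≤ ε
  rw [hscale, norm_smul, norm_inv, Real.norm_of_nonneg hκ0.le, inv_mul_le_iff₀ hκ0]
  have hκt : κ * t ≤ κ := mul_le_of_le_one_right hκ0.le ht.2
  -- Uniformity in `t`: long rescaled intervals use the averaged bound, short ones the trivial bound
  -- `T₀ / κ ≤ ε`.
  rcases le_total T₀ (κ * t) with hle | hle
  · refine (hT _ hle).trans ?_
    nlinarith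
  · refine (intervalIntegral.norm_integral_le_of_norm_le_const (C := 1) fun u _ => heb u).trans ?_
    rw [div_le_iff₀ hε] at hκ
    rw [one_mul, sub_zero, abs_of_nonneg (mul_nonneg hκ0.le ht.1)]
    exact hle.trans hκ

variable {Ω : Type*} [MeasurableSpace Ω] {P : Measure Ω} {W X : ℝ≥0 → Ω → ℝ}

/-- A Brownian motion is indistinguishable from a process with measurable marginals and continuous
paths. -/
lemma exists_measurable_continuous_indistinguishable (hW : IsBrownianReal W P) :
    ∃ X : ℝ≥0 → Ω → ℝ, (∀ t, Measurable (X t)) ∧ (∀ ω, Continuous fun t => X t ω) ∧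
      ∀ᵐ ω ∂P, ∀ t, X t ω = W t ω := by
  classical
  set q : ℕ → ℝ≥0 := TopologicalSpace.denseSeq ℝ≥0 with hq
  have haem : ∀ n, AEMeasurable (W (q n)) P := fun n => hW.aemeasurable _
  have hG : ∀ᵐ ω ∂P, Continuous (fun t => W t ω) ∧ ∀ n, W (q n) ω = (haem n).mk _ ω :=
    hW.cont.and (ae_all_iff.2 fun n => (haem n).ae_eq_mk)
  -- Paths are reset to zero on a measurable null set `N`. Off it they are continuous and agree with
  -- measurable versions on a dense sequence of times, so every marginal is a limit of measurable
  -- functions.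
  set N := toMeasurable P {ω | ¬(Continuous (fun t => W t ω) ∧ ∀ n, W (q n) ω = (haem n).mk _ ω)}
    with hN
  have hNm : MeasurableSet N := measurableSet_toMeasurable _ _
  have hN0 : P N = 0 := by
    rw [hN, measure_toMeasurable]
    exact hG
  have hgood : ∀ ω ∉ N, Continuous (fun t => W t ω) ∧ ∀ n, W (q n) ω = (haem n).mk _ ω :=
    fun ω hω => by
      by_contra hcon
      exact hω (subset_toMeasurable _ _ hcon)
  have hcont : ∀ ω, Continuous fun t => N.piecewise (fun _ => (0 : ℝ)) (W t) ω := fun ω => by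
    by_cases hω : ω ∈ N
    · simpa [hω] using continuous_const
    · simpa [hω] using (hgood ω hω).1
  have hmeas : ∀ n, Measurable (N.piecewise (fun _ => (0 : ℝ)) (W (q n))) := fun n => by
    have : N.piecewise (fun _ => (0 : ℝ)) (W (q n))
        = N.piecewise (fun _ => (0 : ℝ)) ((haem n).mk _) := by
      ext ω
      by_cases hω : ω ∈ N
      · simp [hω]
      · simp [hω, (hgood ω hω).2 n]
    rw [this]
    exact measurable_const.piecewise hNm (haem n).measurable_mk
  refine ⟨fun t => N.piecewise (fun _ => 0) (W t), fun t => ?_, hcont, ?_⟩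
  · have ht : t ∈ closure (range q) := TopologicalSpace.denseRange_denseSeq ℝ≥0 t
    obtain ⟨x, hx, hxt⟩ := mem_closure_iff_seq_limit.1 ht
    choose k hk using hx
    refine measurable_of_tendsto_metrizable (fun n => hmeas (k n)) (tendsto_pi_nhds.2 fun ω => ?_)
    simp only [hk]
    exact ((hcont ω).tendsto t).comp hxt
  · have : ∀ᵐ ω ∂P, ω ∉ N := measure_eq_zero_iff_ae_notMem.1 hN0
    filter_upwards [this] with ω hω t
    simp [hω]

lemma integral_exp_increment (hX : IsPreBrownianReal X P) (c : ℝ) (s t : ℝ≥0) :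
    ∫ ω, Complex.exp (c * (X s ω - X t ω : ℝ) * Complex.I) ∂P
      = (Real.exp (-(c ^ 2 / 2 * |(s : ℝ) - t|)) : ℂ) := by
  have h := (hX.hasLaw_sub s t).integral_comp
    (f := fun x : ℝ => Complex.exp (c * x * Complex.I))
    (by fun_prop : Continuous fun x : ℝ => Complex.exp (c * x * Complex.I)).aestronglyMeasurable
  rw [← charFun_apply_real, charFun_gaussianReal] at h
  refine h.trans ?_
  rw [Complex.ofReal_exp]
  congr 1
  have hd : ((nndist s.1 t.1 : ℝ≥0) : ℝ) = |(s : ℝ) - t| := by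
    rw [coe_nndist, Real.dist_eq]
    rfl
  rw [hd]
  push_cast
  ring

lemma integrable_exp_neg_mul_abs {a : ℝ} (ha : 0 < a) :
    Integrable fun y : ℝ => Real.exp (-(a * |y|)) := by
  rw [← integrableOn_univ, ← Iic_union_Ioi (a := (0 : ℝ)), integrableOn_union]
  constructor
  · refine (integrableOn_exp_mul_Iic ha 0).congr_fun (fun y hy => ?_) measurableSet_Iic
    simp only
    rw [abs_of_nonpos hy]
    ring_nf
  · refine (exp_neg_integrableOn_Ioi 0 ha).congr_fun (fun y hy => ?_) measurableSet_Ioi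
    simp only
    rw [abs_of_pos hy]
    ring_nf

/-- For fixed `x`, enlarging the inner integral to the whole line and translating removes `x`, which
leaves linear growth in `T`. -/
lemma integral_prod_exp_neg_mul_abs_sub_le {a T : ℝ} (ha : 0 < a) (hT : 0 ≤ T) :
    ∫ x : ℝ × ℝ, Real.exp (-(a * |x.1 - x.2|))
      ∂((volume.restrict (Ioc 0 T)).prod (volume.restrict (Ioc 0 T)))
      ≤ (∫ y : ℝ, Real.exp (-(a * |y|))) * T := by
  have hint : Integrable (fun x : ℝ × ℝ => Real.exp (-(a * |x.1 - x.2|)))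
      ((volume.restrict (Ioc 0 T)).prod (volume.restrict (Ioc 0 T))) := by
    refine Integrable.of_bound (C := 1) (by fun_prop :
      Continuous fun x : ℝ × ℝ => Real.exp (-(a * |x.1 - x.2|))).aestronglyMeasurable
      (Eventually.of_forall fun x => ?_)
    rw [Real.norm_of_nonneg (Real.exp_nonneg _), Real.exp_le_one_iff, neg_nonpos]
    positivity
  rw [integral_prod _ hint]
  calc ∫ x in Ioc 0 T, ∫ y in Ioc 0 T, Real.exp (-(a * |x - y|))
      ≤ ∫ _ in Ioc 0 T, ∫ y : ℝ, Real.exp (-(a * |y|)) := by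
        refine integral_mono hint.integral_prod_left (integrable_const _) fun x => ?_
        simp only
        rw [← integral_sub_left_eq_self (fun y => Real.exp (-(a * |y|))) volume x]
        exact setIntegral_le_integral ((integrable_exp_neg_mul_abs ha).comp_sub_left x)
          (Eventually.of_forall fun y => Real.exp_nonneg _)
    _ = _ := by
        rw [setIntegral_const, Real.volume_real_Ioc_of_le hT, sub_zero, smul_eq_mul, mul_comm]

lemma measurable_uncurry_exp (hm : ∀ t, Measurable (X t))
    (hc : ∀ ω, Continuous fun t => X t ω) (c : ℝ) :
    Measurable fun p : Ω × ℝ => Complex.exp (c * (X p.2.toNNReal p.1 : ℝ) * Complex.I) := by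
  have h : Measurable (Function.uncurry X) := measurable_uncurry_of_continuous_of_measurable hc hm
  have h' : Measurable fun p : Ω × ℝ => X p.2.toNNReal p.1 :=
    h.comp ((measurable_real_toNNReal.comp measurable_snd).prodMk measurable_fst)
  fun_prop

lemma integrable_mul_conj [IsFiniteMeasure P] {ν : Measure ℝ} [IsFiniteMeasure ν]
    {e : Ω → ℝ → ℂ} (he : Measurable fun p : Ω × ℝ => e p.1 p.2) (hb : ∀ ω u, ‖e ω u‖ = 1) :
    Integrable (Function.uncurry fun (ω : Ω) (x : ℝ × ℝ) =>
      e ω x.1 * (starRingEnd ℂ) (e ω x.2)) (P.prod (ν.prod ν)) := by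
  refine Integrable.of_bound (C := 1) ?_ (Eventually.of_forall fun p => ?_)
  · have h1 : Measurable fun p : Ω × ℝ × ℝ => e p.1 p.2.1 :=
      he.comp (measurable_fst.prodMk (measurable_fst.comp measurable_snd))
    have h2 : Measurable fun p : Ω × ℝ × ℝ => e p.1 p.2.2 :=
      he.comp (measurable_fst.prodMk (measurable_snd.comp measurable_snd))
    exact (h1.mul (Complex.continuous_conj.measurable.comp h2)).aestronglyMeasurable
  · simp [Function.uncurry, hb]

/-- The square is a double integral over two times; Fubini brings in the covariance, which is the
Gaussian characteristic function of an increment. -/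
lemma integral_norm_sq_integral_exp_le (hX : IsPreBrownianReal X P) (hm : ∀ t, Measurable (X t))
    (hc : ∀ ω, Continuous fun t => X t ω) {c : ℝ} (hc0 : c ≠ 0) {T : ℝ} (hT : 0 ≤ T) :
    ∫ ω, ‖∫ u in (0 : ℝ)..T, Complex.exp (c * (X u.toNNReal ω : ℝ) * Complex.I)‖ ^ 2 ∂P
      ≤ (∫ y : ℝ, Real.exp (-(c ^ 2 / 2 * |y|))) * T := by
  have := hX.isGaussianProcess.isProbabilityMeasure
  set ν : Measure ℝ := volume.restrict (Ioc 0 T) with hν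
  set e : Ω → ℝ → ℂ := fun ω u => Complex.exp (c * (X u.toNNReal ω : ℝ) * Complex.I) with he
  have hem : Measurable fun p : Ω × ℝ => e p.1 p.2 := measurable_uncurry_exp hm hc c
  have hsq : ∀ ω, ((‖∫ u in (0 : ℝ)..T, e ω u‖ ^ 2 : ℝ) : ℂ)
      = ∫ x : ℝ × ℝ, e ω x.1 * (starRingEnd ℂ) (e ω x.2) ∂(ν.prod ν) := fun ω => by
    rw [integral_prod_mul (e ω) (fun u => (starRingEnd ℂ) (e ω u)), integral_conj,
      Complex.mul_conj', intervalIntegral.integral_of_le hT, Complex.ofReal_pow]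
  have hint := integrable_mul_conj (P := P) (ν := ν) hem fun ω u => norm_exp_mul_I _ _
  have hcov : ∀ u v : ℝ, 0 < u → 0 < v → ∫ ω, e ω u * (starRingEnd ℂ) (e ω v) ∂P
      = ((Real.exp (-(c ^ 2 / 2 * |u - v|)) : ℝ) : ℂ) := fun u v hu hv => by
    have h := integral_exp_increment hX c u.toNNReal v.toNNReal
    rw [Real.coe_toNNReal _ hu.le, Real.coe_toNNReal _ hv.le] at h
    rw [← h]
    refine integral_congr_ae (Eventually.of_forall fun ω => ?_)
    simp only [he]
    rw [← Complex.exp_conj, ← Complex.exp_add]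
    congr 1
    simp only [map_mul, Complex.conj_ofReal, Complex.conj_I, Complex.ofReal_sub]
    ring
  have key : ((∫ ω, ‖∫ u in (0 : ℝ)..T, e ω u‖ ^ 2 ∂P : ℝ) : ℂ)
      = ((∫ x : ℝ × ℝ, Real.exp (-(c ^ 2 / 2 * |x.1 - x.2|)) ∂(ν.prod ν) : ℝ) : ℂ) := by
    rw [← integral_complex_ofReal, ← integral_complex_ofReal]
    rw [integral_congr_ae (Eventually.of_forall hsq), integral_integral_swap hint]
    refine integral_congr_ae ?_
    rw [hν, Measure.prod_restrict]
    filter_upwards [ae_restrict_mem (measurableSet_Ioc.prod measurableSet_Ioc)] with x hx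
    exact hcov x.1 x.2 hx.1.1 hx.2.1
  rw [Complex.ofReal_injective key]
  exact integral_prod_exp_neg_mul_abs_sub_le (by positivity) hT

lemma ae_tendsto_average_sq (hX : IsPreBrownianReal X P) (hm : ∀ t, Measurable (X t))
    (hc : ∀ ω, Continuous fun t => X t ω) {c : ℝ} (hc0 : c ≠ 0) :
    ∀ᵐ ω ∂P, Tendsto (fun k : ℕ => ‖∫ u in (0 : ℝ)..(k : ℝ) ^ 2,
      Complex.exp (c * (X u.toNNReal ω : ℝ) * Complex.I)‖ / (k : ℝ) ^ 2) atTop (𝓝 0) := by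
  have := hX.isGaussianProcess.isProbabilityMeasure
  set K : ℝ := ∫ y : ℝ, Real.exp (-(c ^ 2 / 2 * |y|)) with hK
  have hK0 : 0 ≤ K := integral_nonneg fun y => Real.exp_nonneg _
  set A : ℕ → Ω → ℝ := fun k ω => ‖∫ u in (0 : ℝ)..(k : ℝ) ^ 2,
    Complex.exp (c * (X u.toNNReal ω : ℝ) * Complex.I)‖ / (k : ℝ) ^ 2 with hA
  have hAm : ∀ k, Measurable (A k) := fun k => by
    have h := (measurable_uncurry_exp hm hc c).stronglyMeasurable.integral_prod_right'
      (ν := volume.restrict (Ioc 0 ((k : ℝ) ^ 2)))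
    simp only [hA, intervalIntegral.integral_of_le (sq_nonneg (k : ℝ))]
    exact h.norm.measurable.div_const _
  have hAb : ∀ k ω, A k ω ≤ 1 := fun k ω => by
    refine div_le_one_of_le₀ ?_ (by positivity)
    refine (intervalIntegral.norm_integral_le_of_norm_le_const (C := 1)
      fun u _ => (norm_exp_mul_I c _).le).trans ?_
    rw [one_mul, sub_zero, abs_of_nonneg (by positivity)]
  have hA0 : ∀ k ω, 0 ≤ A k ω := fun k ω => by positivity
  have hAint : ∀ k, Integrable (fun ω => A k ω ^ 2) P := fun k => by
    refine Integrable.of_bound (C := 1) ((hAm k).pow_const 2).aestronglyMeasurable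
      (Eventually.of_forall fun ω => ?_)
    rw [Real.norm_of_nonneg (by positivity)]
    exact pow_le_one₀ (hA0 k ω) (hAb k ω)
  have hmom : ∀ k, ∫⁻ ω, ENNReal.ofReal (A k ω ^ 2) ∂P ≤ ENNReal.ofReal (K * (1 / (k : ℝ) ^ 2)) :=
    fun k => by
    rw [← ofReal_integral_eq_lintegral_ofReal (hAint k)
      (Eventually.of_forall fun ω => by positivity)]
    refine ENNReal.ofReal_le_ofReal ?_
    simp only [hA, div_pow]
    rw [integral_div]
    have h := integral_norm_sq_integral_exp_le hX hm hc hc0 (sq_nonneg (k : ℝ))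
    -- At `k = 0` both sides vanish by the convention for division by zero.
    rcases k.eq_zero_or_pos with rfl | hk
    · simp
    · have hk' : (0 : ℝ) < k := Nat.cast_pos.2 hk
      rw [div_le_iff₀ (by positivity)]
      refine h.trans (le_of_eq ?_)
      rw [← hK]
      field_simp
  -- The second moments are at most `K / k²`, so `∑ A_k²` has finite expectation and its terms tend
  -- to zero almost surely.
  have hsum : ∫⁻ ω, ∑' k, ENNReal.ofReal (A k ω ^ 2) ∂P ≠ ⊤ := by
    rw [lintegral_tsum fun k => ((hAm k).pow_const 2).ennreal_ofReal.aemeasurable]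
    have hs : Summable fun k : ℕ => K * (1 / (k : ℝ) ^ 2) :=
      (Real.summable_one_div_nat_pow.2 one_lt_two).mul_left K
    refine ne_top_of_le_ne_top ?_ (ENNReal.tsum_le_tsum hmom)
    rw [← ENNReal.ofReal_tsum_of_nonneg (fun k => by positivity) hs]
    exact ENNReal.ofReal_ne_top
  have hae := ae_lt_top (Measurable.tsum fun k =>
    ((hAm k).pow_const 2).ennreal_ofReal) hsum
  filter_upwards [hae] with ω hω
  have h1 := ENNReal.tendsto_atTop_zero_of_tsum_ne_top hω.ne
  have h2 := (ENNReal.tendsto_toReal ENNReal.zero_ne_top).comp h1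
  have h3 : Tendsto (fun k => A k ω ^ 2) atTop (𝓝 0) := by
    refine h2.congr fun k => ?_
    exact ENNReal.toReal_ofReal (by positivity)
  have h4 := h3.sqrt
  rw [Real.sqrt_zero] at h4
  exact h4.congr fun k => Real.sqrt_sq (hA0 k ω)

/-- Almost surely, the circular Brownian paths of variance `κ` average out as `κ → ∞`. -/
theorem ae_averagesOut_circularPath (hW : IsBrownianReal W P) :
    ∀ᵐ ω ∂P, AveragesOut (fun κ : ℝ => circularPath W κ ω) atTop := by
  obtain ⟨X, hm, hc, hXW⟩ := exists_measurable_continuous_indistinguishable hW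
  have hX : IsPreBrownianReal X P := hW.toIsPreBrownianReal.congr fun t => by
    filter_upwards [hXW] with ω hω using (hω t).symm
  -- Only countably many exponents occur, so one null set serves all of them, and it does not depend
  -- on `κ`.
  have hae : ∀ᵐ ω ∂P, ∀ n : ℤ, n ≠ 0 → Tendsto (fun k : ℕ => ‖∫ u in (0 : ℝ)..(k : ℝ) ^ 2,
      Complex.exp ((n : ℝ) * (X u.toNNReal ω : ℝ) * Complex.I)‖ / (k : ℝ) ^ 2) atTop (𝓝 0) :=
    ae_all_iff.2 fun n => eventually_imp_distrib_left.2 fun hn =>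
      ae_tendsto_average_sq hX hm hc (Int.cast_ne_zero.2 hn)
  filter_upwards [hae, hXW, hW.cont] with ω hω hωX hωc
  refine averagesOut_circularPath_of_tendsto_sq hωc ?_
  simpa only [hωX] using hω

end RadialLoewner

theorem proposition1p1 {Ω : Type*} [MeasurableSpace Ω] (P : Measure Ω)
    (W : ℝ≥0 → Ω → ℝ) (hW : IsBrownianReal W P) :
    ∀ᵐ ω ∂P,
      RadialLoewner.TendstoCaratheodory
        (fun κ : ℝ => RadialLoewner.chain (RadialLoewner.circularPath W κ ω)) atTop
        (fun t z => (Real.exp (-t) : ℂ) * z) ∧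
      ∃ hc : ∀ κ : ℝ, Continuous (RadialLoewner.circularPath W κ ω),
        Tendsto
          (fun κ : ℝ => RadialLoewner.drivingMeasure (RadialLoewner.circularPath W κ ω) (hc κ))
          atTop (𝓝 RadialLoewner.uniformMeasure) := by
  filter_upwards [hW.cont, RadialLoewner.ae_averagesOut_circularPath hW] with ω hω hav
  have hc := RadialLoewner.continuous_circularPath hω
  exact ⟨hav.tendstoCaratheodory hc, hc, hav.tendsto_drivingMeasure hc⟩
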